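/- Let $n\ge 2$, $r\in[-1,1]$ and $\theta=\frac{\arccos r}{n-1}$. Let $x_1,\dots,x_n$ be random variables with zero mean and unit variance, and let $\rho=(\rho_{ij})$ be their true correlation matrix. An $n$-variable recursive model is given by sets $R(k)\subseteq\{1,\dots,k-1\}$, $k=1,\dots,n$; its $k$-th equation is the linear regression $x_k=\sum_{j\in R(k)}\beta_{jk}x_j+\varepsilon_k$, where $\beta_k=\rho_{k,R(k)}(\rho_{R(k),R(k)})^{-1}$ are the OLS coefficients with respect to $\rho$ and $\mathrm{Var}(\varepsilon_k)$ is the true variance of the residual $x_k-\sum_{j\in R(k)}\beta_{jk}x_j$. Substituting the equations successively into one another until $x_1$ is the only remaining explanatory variable gives $x_k=\alpha_k x_1+\sum_{j}\gamma_{kj}\varepsilon_j$. Treating $x_1$ and the $\varepsilon_j$ appearing here as mutually uncorrelated, define the estimates $\widehat{\mathrm{Var}}(x_k)=\alpha_k^2+\sum_j\gamma_{kj}^2\mathrm{Var}(\varepsilon_j)$, $\widehat{\mathrm{Cov}}(x_1,x_k)=\alpha_k$ and $\hat\rho_{1k}=\alpha_k/\sqrt{\widehat{\mathrm{Var}}(x_k)}$.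 (a) For almost every correlation matrix $\rho$ (symmetric positive semidefinite with unit diagonal) satisfying $\rho_{1n}=r$, where "almost every" refers to Lebesgue measure on the entries $\rho_{ij}$, $i<j$, $(i,j)\ne(1,n)$ (so that for $|r|=1$ and $n\ge3$ the set of such matrices is itself null), the following holds. For every $n$-variable recursive model with $\widehat{\mathrm{Var}}(x_k)=1$ for all $k$, $$\hat\rho_{1n}\le(\cos\theta)^{n-1};$$ in the degenerate case $n=2$, $r<0$, the model with $R(2)=\emptyset$ is excluded. (b) The bound is attained. Let $s_1,s_2$ be independent standard normal variables and $x_k=s_1\cos((k-1)\theta)+s_2\sin((k-1)\theta)$ for $k=1,\dots,n$. Then $(x_1,\dots,x_n)$ is jointly Gaussian, each $x_k$ has mean $0$ and variance $1$, and the correlation of $x_1$ and $x_n$ is $r$. For this distribution, the chain model $R(1)=\emptyset$, $R(k)=\{k-1\}$ for $k=2,\dots,n$, satisfies $\widehat{\mathrm{Var}}(x_k)=1$ for all $k$ and $\hat\rho_{1n}=(\cos\theta)^{n-1}$. -/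

import Mathlib

open MeasureTheory ProbabilityTheory
open scoped Matrix

noncomputable section

/-- An `n`-variable recursive linear-regression model, `n = m + 1`. The variables
`x_1, …, x_n` are indexed by `0, …, m`; `R k` is the set of explanatory variables of the
`k`-th regression equation, and only earlier variables may be used. -/
structure RecursiveModel (m : ℕ) where
  /-- the explanatory variables of each equation -/
  R : Fin (m + 1) → Finset (Fin (m + 1))
  /-- the model is recursive -/
  lt_of_mem : ∀ k, ∀ j ∈ R k, j < k

/-- The chain model: `x_k` is regressed on `x_{k-1}` only. -/
def chainModel (m : ℕ) : RecursiveModel m where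
  R k := Finset.univ.filter fun j => j.val + 1 = k.val
  lt_of_mem k j hj := by
    have h := (Finset.mem_filter.mp hj).2
    exact Fin.lt_def.mpr (by omega)

namespace RecursiveModel

variable {m : ℕ}

/-- The OLS coefficients `β_k = ρ_{k,R(k)} (ρ_{R(k),R(k)})⁻¹` of the `k`-th equation, computed
from the true correlation matrix `ρ`. -/
def beta (M : RecursiveModel m) (ρ : Matrix (Fin (m + 1)) (Fin (m + 1)) ℝ) (k : Fin (m + 1)) :
    M.R k → ℝ :=
  (fun j : M.R k => ρ k j) ᵥ*
    (ρ.submatrix (fun i : M.R k => (i : Fin (m + 1))) (fun j : M.R k => (j : Fin (m + 1))))⁻¹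

/-- The variance of the error term `ε_k = x_k - ∑_{j ∈ R(k)} β_{jk} x_j` of the estimated `k`-th
equation (for variables whose true covariance matrix is `ρ`). -/
def errVar (M : RecursiveModel m) (ρ : Matrix (Fin (m + 1)) (Fin (m + 1)) ℝ)
    (k : Fin (m + 1)) : ℝ :=
  ρ k k - 2 * ∑ j : M.R k, M.beta ρ k j * ρ k j
    + ∑ i : M.R k, ∑ j : M.R k, M.beta ρ k i * M.beta ρ k j * ρ i j

/-- Successive substitution of the estimated equations, until the only remaining explanatory
variable is `x_1`, gives `x_k = α_k x_1 + ∑_j γ_{kj} ε_j`. This is `α_k`. -/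
def alpha (M : RecursiveModel m) (ρ : Matrix (Fin (m + 1)) (Fin (m + 1)) ℝ)
    (k : Fin (m + 1)) : ℝ :=
  if k = 0 then 1 else ∑ j : M.R k, M.beta ρ k j * M.alpha ρ j
termination_by k
decreasing_by exact M.lt_of_mem k j j.2

/-- Successive substitution of the estimated equations, until the only remaining explanatory
variable is `x_1`, gives `x_k = α_k x_1 + ∑_j γ_{kj} ε_j`. This is `γ_{ki}`. -/
def gamma (M : RecursiveModel m) (ρ : Matrix (Fin (m + 1)) (Fin (m + 1)) ℝ)
    (k i : Fin (m + 1)) : ℝ :=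
  if k = 0 then 0
  else (if i = k then 1 else 0) + ∑ j : M.R k, M.beta ρ k j * M.gamma ρ j i
termination_by k
decreasing_by exact M.lt_of_mem k j j.2

/-- The estimated variance of `x_k`: the analyst takes `x_1` and all the errors `ε_j`
to be mutually uncorrelated. -/
def estVar (M : RecursiveModel m) (ρ : Matrix (Fin (m + 1)) (Fin (m + 1)) ℝ)
    (k : Fin (m + 1)) : ℝ :=
  M.alpha ρ k ^ 2 * ρ 0 0 + ∑ j, M.gamma ρ k j ^ 2 * M.errVar ρ j

/-- The estimated covariance of `x_1` and `x_k`. -/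
def estCov (M : RecursiveModel m) (ρ : Matrix (Fin (m + 1)) (Fin (m + 1)) ℝ)
    (k : Fin (m + 1)) : ℝ :=
  M.alpha ρ k * ρ 0 0

/-- The estimated correlation of `x_1` and `x_k`. -/
def estCorr (M : RecursiveModel m) (ρ : Matrix (Fin (m + 1)) (Fin (m + 1)) ℝ)
    (k : Fin (m + 1)) : ℝ :=
  M.estCov ρ k / √(ρ 0 0 * M.estVar ρ k)

end RecursiveModel

/-- The positions above the diagonal other than the `(1, n)` corner: the entries that remain free
in a correlation matrix whose `(1, n)` entry is prescribed. -/
abbrev FreePair (m : ℕ) : Type :=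
  {p : Fin (m + 1) × Fin (m + 1) // p.1 < p.2 ∧ p ≠ (0, Fin.last m)}

/-- The symmetric matrix with unit diagonal, `(1, n)` entry `r` and free entries `v`. -/
def fillMatrix {m : ℕ} (r : ℝ) (v : FreePair m → ℝ) : Matrix (Fin (m + 1)) (Fin (m + 1)) ℝ :=
  Matrix.of fun i j =>
    if h : i < j ∧ (i, j) ≠ (0, Fin.last m) then v ⟨(i, j), h⟩
    else if h : j < i ∧ (j, i) ≠ (0, Fin.last m) then v ⟨(j, i), h⟩
    else if i = j then 1 else r

/-- The correlation matrix of the coordinates under a distribution `p` of `(x_1, …, x_n)`. -/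
def corrMatrix {m : ℕ} (p : Measure (Fin (m + 1) → ℝ)) : Matrix (Fin (m + 1)) (Fin (m + 1)) ℝ :=
  Matrix.of fun i j =>
    cov[fun x => x i, fun x => x j; p] / √(Var[fun x => x i; p] * Var[fun x => x j; p])

/-- The joint law of `x_k = s₁ cos ((k - 1) θ) + s₂ sin ((k - 1) θ)`, `k = 1, …, n`, where
`s₁, s₂` are independent standard normal variables. -/
def planarGaussian (m : ℕ) (θ : ℝ) : Measure (Fin (m + 1) → ℝ) :=
  ((gaussianReal 0 1).prod (gaussianReal 0 1)).map fun s k =>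
    s.1 * Real.cos ((k : ℝ) * θ) + s.2 * Real.sin ((k : ℝ) * θ)

end

/-! The upper bound combines a genericity argument with a geometric one.

Genericity (`ae_isPerfect_of_estVar_eq_one`): the error in the estimated variance of `x_k` is the
quadratic form `β_kᵀ D β_k`, where `D` is the estimated minus the true covariance of the parents of
`x_k` (`estVar_eq`). Let `k` be the first equation with two unlinked parents `i < j`. No earlier
equation uses `ρ i j`, so the estimated covariance of `x_i` and `x_j` ignores this entry and
generically differs from it: `D i j ≠ 0`. If the variances of these two parents are right, moving
the `k`-th row of `ρ` moves `β_k` along a line on which the form is a nonzero quadratic, so it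
generically does not vanish. Hence correct variances force every parent set to be a clique.

Geometry (`alpha_last_le`): take unit vectors with Gram matrix `ρ`. For clique models `α_k` is the
inner product of `x_k` with a vector that is either zero or obtained from `x_1` by successive
orthogonal projections onto spans of parents. Each nonzero projection scales the length by the
cosine of an acute angle, and by the triangle inequality for angles these angles, together with the
final one to `x_n`, sum to at least `arccos r`. At most `n - 1` angles occur, so AM-GM and concavity
of the cosine give the bound.

Equality occurs for unit vectors spaced evenly in a plane, with the chain model projecting from each
to the next. -/

namespace RecursiveModel

/-! ### Normal equations, substitution and estimated covariances -/

variable {m : ℕ}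

/-- The correlation matrix of the explanatory variables of the `k`-th equation. -/
abbrev parentMatrix (M : RecursiveModel m) (ρ : Matrix (Fin (m + 1)) (Fin (m + 1)) ℝ)
    (k : Fin (m + 1)) : Matrix (M.R k) (M.R k) ℝ :=
  ρ.submatrix (fun i : M.R k => (i : Fin (m + 1))) (fun j : M.R k => (j : Fin (m + 1)))

/-- The explanatory variables of every equation are pairwise linked. -/
def IsPerfectBelow (M : RecursiveModel m) (k : Fin (m + 1)) : Prop :=
  ∀ l < k, ∀ j ∈ M.R l, ∀ i ∈ M.R l, i < j → i ∈ M.R j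

/-- The covariance of `x_a` and `x_b` under the estimated model. -/
noncomputable def modelCov (M : RecursiveModel m) (ρ : Matrix (Fin (m + 1)) (Fin (m + 1)) ℝ)
    (a b : Fin (m + 1)) : ℝ :=
  M.alpha ρ a * M.alpha ρ b * ρ 0 0 + ∑ i, M.gamma ρ a i * M.gamma ρ b i * M.errVar ρ i

variable (M : RecursiveModel m) (ρ : Matrix (Fin (m + 1)) (Fin (m + 1)) ℝ)

theorem beta_normal_eq {k : Fin (m + 1)} (h : (M.parentMatrix ρ k).det ≠ 0) (j : M.R k) :
    ∑ i, M.beta ρ k i * ρ i j = ρ k j := by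
  have hu : IsUnit (M.parentMatrix ρ k).det := isUnit_iff_ne_zero.mpr h
  have : M.beta ρ k ᵥ* M.parentMatrix ρ k = fun j : M.R k => ρ k j := by
    unfold beta
    rw [Matrix.vecMul_vecMul, Matrix.nonsing_inv_mul _ hu, Matrix.vecMul_one]
  exact congrFun this j

/-- The normal equations determine the OLS coefficients. -/
theorem beta_eq_of_normal_eq {k : Fin (m + 1)} (h : (M.parentMatrix ρ k).det ≠ 0)
    {b : M.R k → ℝ} (hb : ∀ j : M.R k, ∑ i, b i * ρ i j = ρ k j) : M.beta ρ k = b := by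
  have hu : IsUnit (M.parentMatrix ρ k).det := isUnit_iff_ne_zero.mpr h
  have : b ᵥ* M.parentMatrix ρ k = fun j : M.R k => ρ k j := funext hb
  unfold beta
  rw [← this, Matrix.vecMul_vecMul, Matrix.mul_nonsing_inv _ hu, Matrix.vecMul_one]

theorem alpha_zero : M.alpha ρ 0 = 1 := by
  rw [alpha]; simp

theorem alpha_of_ne_zero {k : Fin (m + 1)} (hk : k ≠ 0) :
    M.alpha ρ k = ∑ j : M.R k, M.beta ρ k j * M.alpha ρ j := by
  rw [alpha, if_neg hk]

theorem gamma_zero (i : Fin (m + 1)) : M.gamma ρ 0 i = 0 := by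
  rw [gamma]; simp

theorem gamma_of_ne_zero {k : Fin (m + 1)} (hk : k ≠ 0) (i : Fin (m + 1)) :
    M.gamma ρ k i = (if i = k then 1 else 0) + ∑ j : M.R k, M.beta ρ k j * M.gamma ρ j i := by
  rw [gamma, if_neg hk]

theorem gamma_eq_zero_of_lt {k i : Fin (m + 1)} (h : k < i) : M.gamma ρ k i = 0 := by
  induction k using WellFoundedLT.induction with
  | ind k ih =>
    by_cases hk : k = 0
    · rw [hk, gamma_zero]
    · rw [gamma_of_ne_zero _ _ hk, if_neg h.ne', zero_add]
      refine Finset.sum_eq_zero fun j _ => ?_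
      have hj := M.lt_of_mem k j j.2
      rw [ih j hj (hj.trans h), mul_zero]

theorem gamma_self {k : Fin (m + 1)} (hk : k ≠ 0) : M.gamma ρ k k = 1 := by
  rw [gamma_of_ne_zero _ _ hk, if_pos rfl, add_eq_left]
  exact Finset.sum_eq_zero fun j _ => by
    rw [gamma_eq_zero_of_lt _ _ (M.lt_of_mem k j j.2), mul_zero]

theorem modelCov_comm (a b : Fin (m + 1)) : M.modelCov ρ a b = M.modelCov ρ b a := by
  unfold modelCov
  congr 1
  · ring
  · exact Finset.sum_congr rfl fun i _ => by ring

theorem modelCov_self (a : Fin (m + 1)) : M.modelCov ρ a a = M.estVar ρ a := by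
  unfold modelCov estVar
  simp only [sq]

theorem modelCov_of_ne_zero {k : Fin (m + 1)} (hk : k ≠ 0) (a : Fin (m + 1)) :
    M.modelCov ρ k a = ∑ j : M.R k, M.beta ρ k j * M.modelCov ρ j a
      + M.gamma ρ a k * M.errVar ρ k := by
  unfold modelCov
  simp only [alpha_of_ne_zero M ρ hk, gamma_of_ne_zero M ρ hk, add_mul, Finset.sum_add_distrib,
    mul_add, ite_mul, zero_mul, one_mul, Finset.sum_ite_eq', Finset.mem_univ, if_true,
    Finset.sum_mul, Finset.mul_sum]
  rw [Finset.sum_comm (s := (Finset.univ : Finset (Fin (m + 1))))]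
  simp only [mul_assoc]
  ring

theorem modelCov_of_lt {k a : Fin (m + 1)} (h : a < k) :
    M.modelCov ρ k a = ∑ j : M.R k, M.beta ρ k j * M.modelCov ρ j a := by
  rw [modelCov_of_ne_zero M ρ (Fin.ne_zero_of_lt h), gamma_eq_zero_of_lt M ρ h, zero_mul, add_zero]

theorem modelCov_self_of_ne_zero {k : Fin (m + 1)} (hk : k ≠ 0) :
    M.modelCov ρ k k = ∑ i : M.R k, ∑ j : M.R k, M.beta ρ k i * M.beta ρ k j * M.modelCov ρ i j
      + M.errVar ρ k := by
  rw [modelCov_of_ne_zero M ρ hk, gamma_self M ρ hk, one_mul]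
  congr 1
  refine Finset.sum_congr rfl fun i _ => ?_
  rw [modelCov_comm, modelCov_of_lt M ρ (M.lt_of_mem k i i.2), Finset.mul_sum]
  exact Finset.sum_congr rfl fun j _ => by rw [modelCov_comm M ρ j i]; ring

/-- By the normal equations the covariance of `x_k` with its fitted value equals the variance of the
fitted value. -/
theorem errVar_eq {k : Fin (m + 1)} (h : (M.parentMatrix ρ k).det ≠ 0) :
    M.errVar ρ k =
      ρ k k - ∑ i : M.R k, ∑ j : M.R k, M.beta ρ k i * M.beta ρ k j * ρ i j := by
  have : ∑ i : M.R k, ∑ j : M.R k, M.beta ρ k i * M.beta ρ k j * ρ i j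
      = ∑ j : M.R k, M.beta ρ k j * ρ k j := by
    rw [Finset.sum_comm]
    refine Finset.sum_congr rfl fun j _ => ?_
    rw [← beta_normal_eq M ρ h j, Finset.mul_sum]
    exact Finset.sum_congr rfl fun i _ => by ring
  unfold errVar
  rw [this]
  ring

/-- The estimated variance exceeds the true one by the distortion of the variance of the
fitted value. -/
theorem estVar_eq {k : Fin (m + 1)} (hk : k ≠ 0) (h : (M.parentMatrix ρ k).det ≠ 0) :
    M.estVar ρ k = ρ k k + ∑ i : M.R k, ∑ j : M.R k,
      M.beta ρ k i * M.beta ρ k j * (M.modelCov ρ i j - ρ i j) := by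
  rw [← modelCov_self, modelCov_self_of_ne_zero M ρ hk, errVar_eq M ρ h]
  simp only [mul_sub, Finset.sum_sub_distrib]
  ring

theorem estVar_zero : M.estVar ρ 0 = ρ 0 0 := by
  simp [estVar, alpha_zero, gamma_zero]

/-! ### Which entries of `ρ` the estimates depend on -/

section Congr

variable {ρ} {ρ' : Matrix (Fin (m + 1)) (Fin (m + 1)) ℝ}

theorem beta_congr {k : Fin (m + 1)}
    (h : ∀ i ∈ insert k (M.R k), ∀ j ∈ insert k (M.R k), ρ i j = ρ' i j) :
    M.beta ρ k = M.beta ρ' k := by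
  unfold beta
  have h1 : (fun j : M.R k => ρ k j) = fun j : M.R k => ρ' k j :=
    funext fun j => h _ (by simp) _ (by simp)
  have h2 : M.parentMatrix ρ k = M.parentMatrix ρ' k := by
    ext i j
    exact h _ (by simp) _ (by simp)
  unfold parentMatrix at h2
  rw [h1, h2]

theorem errVar_congr {k : Fin (m + 1)}
    (h : ∀ i ∈ insert k (M.R k), ∀ j ∈ insert k (M.R k), ρ i j = ρ' i j) :
    M.errVar ρ k = M.errVar ρ' k := by
  unfold errVar
  rw [beta_congr M h, h k (by simp) k (by simp)]
  congr 1
  · congr 2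
    exact Finset.sum_congr rfl fun j _ => by rw [h k (by simp) j (by simp)]
  · exact Finset.sum_congr rfl fun i _ => Finset.sum_congr rfl fun j _ => by
      rw [h i (by simp) j (by simp)]

/-- Only pairs lying together in some `{l} ∪ R(l)` with `l < k` are read. This allows other entries
to be perturbed while the estimates stay fixed. -/
theorem modelCov_congr {k : Fin (m + 1)}
    (h : ∀ l < k, ∀ i ∈ insert l (M.R l), ∀ j ∈ insert l (M.R l), ρ i j = ρ' i j)
    {a b : Fin (m + 1)} (ha : a < k) (hb : b < k) : M.modelCov ρ a b = M.modelCov ρ' a b := by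
  have h0 : ρ 0 0 = ρ' 0 0 := h 0 (lt_of_le_of_lt (Fin.zero_le a) ha) 0 (by simp) 0 (by simp)
  have hα : ∀ l < k, M.alpha ρ l = M.alpha ρ' l := by
    intro l
    induction l using WellFoundedLT.induction with
    | ind l ih =>
      intro hl
      by_cases hl0 : l = 0
      · rw [hl0, alpha_zero, alpha_zero]
      · rw [alpha_of_ne_zero _ _ hl0, alpha_of_ne_zero _ _ hl0, beta_congr M (h l hl)]
        refine Finset.sum_congr rfl fun j _ => ?_
        have hj := M.lt_of_mem l j j.2
        rw [ih j hj (hj.trans hl)]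
  have hγ : ∀ l < k, ∀ i, M.gamma ρ l i = M.gamma ρ' l i := by
    intro l
    induction l using WellFoundedLT.induction with
    | ind l ih =>
      intro hl i
      by_cases hl0 : l = 0
      · rw [hl0, gamma_zero, gamma_zero]
      · rw [gamma_of_ne_zero _ _ hl0, gamma_of_ne_zero _ _ hl0, beta_congr M (h l hl)]
        congr 1
        refine Finset.sum_congr rfl fun j _ => ?_
        have hj := M.lt_of_mem l j j.2
        rw [ih j hj (hj.trans hl)]
  unfold modelCov
  rw [hα a ha, hα b hb, h0]
  congr 1
  refine Finset.sum_congr rfl fun i _ => ?_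
  rw [hγ a ha, hγ b hb]
  by_cases hi : i < k
  · rw [errVar_congr M (h i hi)]
  -- The variances of later errors may differ, but those errors do not enter `x_a`.
  · rw [gamma_eq_zero_of_lt M ρ' (ha.trans_le (not_lt.mp hi))]
    ring

end Congr

end RecursiveModel

/-! ### Products of cosines and successive projections -/

section ProductOfCosines

open Real Finset

/-- AM-GM bounds the geometric mean of the cosines by their arithmetic mean, and Jensen bounds that
by the cosine of the mean angle. -/
theorem prod_cos_le_cos_mean_pow {m : ℕ} (hm : 0 < m) {φ : ℕ → ℝ}
    (hφ : ∀ i, φ i ∈ Set.Icc 0 (π / 2)) :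
    ∏ i ∈ range m, cos (φ i) ≤ cos ((∑ i ∈ range m, φ i) / m) ^ m := by
  have hm' : (0 : ℝ) < m := by exact_mod_cast hm
  have hnonneg : ∀ i, 0 ≤ cos (φ i) := fun i =>
    cos_nonneg_of_mem_Icc ⟨by linarith [(hφ i).1, pi_pos], (hφ i).2⟩
  have hw : ∑ _i ∈ range m, (1 / m : ℝ) = 1 := by
    rw [sum_const, card_range, nsmul_eq_mul]; field_simp
  have amgm := geom_mean_le_arith_mean_weighted (range m) (fun _ => (1 / m : ℝ))
    (fun i => cos (φ i)) (fun _ _ => by positivity) hw (fun i _ => hnonneg i)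
  have jensen := strictConcaveOn_cos_Icc.concaveOn.le_map_sum (t := range m)
    (w := fun _ => (1 / m : ℝ)) (p := φ) (fun _ _ => by positivity) hw
    (fun i _ => ⟨by linarith [(hφ i).1, pi_pos], (hφ i).2⟩)
  have hprod : 0 ≤ ∏ i ∈ range m, cos (φ i) ^ (1 / m : ℝ) :=
    prod_nonneg fun i _ => rpow_nonneg (hnonneg i) _
  calc ∏ i ∈ range m, cos (φ i)
      = (∏ i ∈ range m, cos (φ i) ^ (1 / m : ℝ)) ^ m := by
        rw [← prod_pow]
        refine prod_congr rfl fun i _ => ?_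
        rw [one_div, rpow_inv_natCast_pow (hnonneg i) hm.ne']
    _ ≤ cos (∑ i ∈ range m, (1 / m : ℝ) • φ i) ^ m := by
        refine pow_le_pow_left₀ hprod (amgm.trans ?_) m
        simpa only [smul_eq_mul] using jensen
    _ = cos ((∑ i ∈ range m, φ i) / m) ^ m := by
        rw [← smul_sum, smul_eq_mul, one_div, inv_mul_eq_div]

/-- `m` acute angles of total size at least `t` have product of cosines at most
`(cos (t / m)) ^ m`. -/
theorem prod_cos_le_cos_div_pow {m : ℕ} (hm : 0 < m) {φ : ℕ → ℝ}
    (hφ : ∀ i, φ i ∈ Set.Icc 0 (π / 2)) {t : ℝ} (ht : 0 ≤ t) (hsum : t ≤ ∑ i ∈ range m, φ i) :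
    ∏ i ∈ range m, cos (φ i) ≤ cos (t / m) ^ m := by
  have hm' : (0 : ℝ) < m := by exact_mod_cast hm
  refine (prod_cos_le_cos_mean_pow hm hφ).trans ?_
  have hle : (∑ i ∈ range m, φ i) / m ≤ π / 2 := by
    rw [div_le_iff₀ hm']
    calc ∑ i ∈ range m, φ i ≤ ∑ _i ∈ range m, π / 2 := sum_le_sum fun i _ => (hφ i).2
      _ = π / 2 * m := by rw [sum_const, card_range, nsmul_eq_mul, mul_comm]
  have h0 : 0 ≤ t / m := by positivity
  have hdiv : t / m ≤ (∑ i ∈ range m, φ i) / m := by gcongr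
  refine pow_le_pow_left₀ (cos_nonneg_of_mem_Icc ⟨by linarith [pi_pos], hle⟩) ?_ m
  exact cos_le_cos_of_nonneg_of_le_pi h0 (by linarith [pi_pos]) hdiv

variable {E : Type*} [NormedAddCommGroup E] [InnerProductSpace ℝ E]

open InnerProductGeometry RealInnerProductSpace

/-- The length of `a` is a product of the cosines of `N` acute angles, whose sum is at least the
angle between `x` and `a`. -/
def IsShortenedBy (x a : E) (N : ℕ) : Prop :=
  ∃ φ : ℕ → ℝ, (∀ i, φ i ∈ Set.Icc 0 (π / 2)) ∧ ‖a‖ = ∏ i ∈ range N, cos (φ i) ∧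
    angle x a ≤ ∑ i ∈ range N, φ i

theorem isShortenedBy_self {x : E} (hx : ‖x‖ = 1) : IsShortenedBy x x 0 :=
  ⟨fun _ => 0, fun _ => ⟨le_rfl, by positivity⟩, by simpa using hx,
    by simp [angle_self (norm_ne_zero_iff.mp (hx ▸ one_ne_zero))]⟩

theorem exists_angles_of_isShortenedBy {x b c : E} {N : ℕ} (h : IsShortenedBy x b N)
    (hbc : 0 ≤ ⟪b, c⟫) :
    ∃ φ : ℕ → ℝ, (∀ i, φ i ∈ Set.Icc 0 (π / 2)) ∧
      ‖b‖ * cos (angle b c) = ∏ i ∈ range (N + 1), cos (φ i) ∧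
      angle x c ≤ ∑ i ∈ range (N + 1), φ i := by
  obtain ⟨φ, hφ, hn, ha⟩ := h
  have hne : ∀ i ∈ range N, Function.update φ N (angle b c) i = φ i := fun i hi =>
    Function.update_of_ne (mem_range.mp hi).ne _ _
  refine ⟨Function.update φ N (angle b c), fun i => ?_, ?_, ?_⟩
  · by_cases hi : i = N
    · subst hi
      rw [Function.update_self]
      exact ⟨angle_nonneg _ _, arccos_le_pi_div_two.mpr (by positivity)⟩
    · rw [Function.update_of_ne hi]
      exact hφ i
  · rw [prod_range_succ, Function.update_self, hn]
    congr 1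
    exact prod_congr rfl fun i hi => by rw [hne i hi]
  · rw [sum_range_succ, Function.update_self, sum_congr rfl hne]
    exact (angle_le_angle_add_angle x b c).trans (by gcongr)

/-- Since `⟪b, P b⟫ = ‖P b‖²`, the length shrinks by exactly the cosine of the acute angle between
`b` and `P b`. -/
theorem IsShortenedBy.starProjection {x b : E} {N : ℕ} (h : IsShortenedBy x b N)
    (V : Submodule ℝ E) [V.HasOrthogonalProjection] (hb : V.starProjection b ≠ 0) :
    IsShortenedBy x (V.starProjection b) (N + 1) := by
  have hinner : ⟪b, V.starProjection b⟫ = ‖V.starProjection b‖ * ‖V.starProjection b‖ := by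
    rw [← real_inner_self_eq_norm_mul_norm, real_inner_comm, ← sub_eq_zero, ← inner_sub_right]
    rw [real_inner_comm]
    exact V.starProjection_inner_eq_zero b _ (V.starProjection_apply_mem b)
  obtain ⟨φ, hφ, hn, ha⟩ := exists_angles_of_isShortenedBy h
    (c := V.starProjection b) (hinner ▸ mul_self_nonneg _)
  refine ⟨φ, hφ, hn ▸ ?_, ha⟩
  have := cos_angle_mul_norm_mul_norm b (V.starProjection b)
  rw [hinner, ← mul_assoc, mul_comm (cos _)] at this
  exact (mul_right_cancel₀ (norm_ne_zero_iff.mpr hb) this).symm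

theorem inner_le_cos_div_pow {m N : ℕ} (hm : 2 ≤ m) (hN : N + 1 ≤ m) {x a y : E}
    (hy : ‖y‖ = 1) (h : IsShortenedBy x a N) :
    ⟪a, y⟫ ≤ cos (angle x y / m) ^ m := by
  have hm' : (2 : ℝ) ≤ m := by exact_mod_cast hm
  rcases lt_or_ge ⟪a, y⟫ 0 with hneg | hpos
  -- The right-hand side is nonnegative because `m ≥ 2` puts `angle x y / m` in `[0, π / 2]`.
  · refine hneg.le.trans (pow_nonneg (cos_nonneg_of_mem_Icc ⟨?_, ?_⟩) m)
    · have : 0 ≤ angle x y / m := div_nonneg (angle_nonneg _ _) (by positivity)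
      linarith [pi_pos]
    · have := angle_le_pi x y
      rw [div_le_iff₀ (by positivity)]
      nlinarith [pi_pos]
  · obtain ⟨φ, hφ, hn, ha⟩ := exists_angles_of_isShortenedBy h hpos
    have hsub : range (N + 1) ⊆ range m := range_subset_range.mpr hN
    -- Padding with zero angles up to `m` changes neither the product of cosines nor the sum.
    let ψ : ℕ → ℝ := fun i => if i < N + 1 then φ i else 0
    have hψ : ∀ i, ψ i ∈ Set.Icc 0 (π / 2) := fun i => by
      by_cases hi : i < N + 1
      · simpa only [ψ, if_pos hi] using hφ i
      · simp only [ψ, if_neg hi]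
        exact ⟨le_rfl, by positivity⟩
    have hprod : ∏ i ∈ range (N + 1), cos (φ i) = ∏ i ∈ range m, cos (ψ i) := by
      rw [← prod_subset hsub fun i _ hi => by simp only [ψ, if_neg (mem_range.not.mp hi), cos_zero]]
      exact prod_congr rfl fun i hi => by simp only [ψ, if_pos (mem_range.mp hi)]
    have hsum : ∑ i ∈ range (N + 1), φ i = ∑ i ∈ range m, ψ i := by
      rw [← sum_subset hsub fun i _ hi => by simp only [ψ, if_neg (mem_range.not.mp hi)]]
      exact sum_congr rfl fun i hi => by simp only [ψ, if_pos (mem_range.mp hi)]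
    calc ⟪a, y⟫ = ∏ i ∈ range m, cos (ψ i) := by
          rw [← hprod, ← hn, ← cos_angle_mul_norm_mul_norm, hy]; ring
      _ ≤ _ := prod_cos_le_cos_div_pow (by omega) hψ (angle_nonneg _ _) (hsum ▸ ha)

end ProductOfCosines

/-! ### The bound for clique models, via Gram vectors -/

namespace RecursiveModel

open RealInnerProductSpace

variable {m : ℕ} {E : Type*} [NormedAddCommGroup E] [InnerProductSpace ℝ E]
  (M : RecursiveModel m) {ρ : Matrix (Fin (m + 1)) (Fin (m + 1)) ℝ} {x : Fin (m + 1) → E}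

/-- The regression residual of `x k` is orthogonal to the span of the parents, so `x k` may be
replaced by its fitted value, and `alpha` obeys the same recursion. -/
theorem inner_eq_alpha_of_mem_span (hx : ∀ i j, ⟪x i, x j⟫ = ρ i j) {k : Fin (m + 1)} (hk : k ≠ 0)
    (hdet : (M.parentMatrix ρ k).det ≠ 0) {a : E}
    (ha : a ∈ Submodule.span ℝ (x '' (M.R k : Set (Fin (m + 1)))))
    (haR : ∀ j ∈ M.R k, ⟪a, x j⟫ = M.alpha ρ j) : ⟪a, x k⟫ = M.alpha ρ k := by
  have horth : ∀ b ∈ Submodule.span ℝ (x '' (M.R k : Set (Fin (m + 1)))),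
      ⟪b, ∑ j : M.R k, M.beta ρ k j • x j - x k⟫ = 0 := by
    intro b hb
    induction hb using Submodule.span_induction with
    | mem y hy =>
      obtain ⟨j, hj, rfl⟩ := hy
      have := beta_normal_eq M ρ hdet ⟨j, hj⟩
      rw [inner_sub_right, inner_sum, sub_eq_zero, real_inner_comm, hx, ← this]
      exact Finset.sum_congr rfl fun i _ => by
        rw [real_inner_smul_right, real_inner_comm, hx]
    | zero => simp
    | add y z _ _ hy hz => rw [inner_add_left, hy, hz, add_zero]
    | smul c y _ hy => rw [real_inner_smul_left, hy, mul_zero]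
  have h := horth a ha
  rw [inner_sub_right, inner_sum, sub_eq_zero] at h
  rw [← h, alpha_of_ne_zero M ρ hk]
  exact Finset.sum_congr rfl fun j _ => by rw [real_inner_smul_right, haR j j.2]

/-- When the last parent `l` of `k` is not `0`, the vector for `k` is the projection of the vector
for `l` onto the span of `R k`. The count `k - 1` leaves room for one more angle, to `x k` itself.
-/
theorem exists_isShortenedBy (hx : ∀ i j, ⟪x i, x j⟫ = ρ i j) (hd : ∀ i, ρ i i = 1)
    (hM : ∀ l, ∀ j ∈ M.R l, ∀ i ∈ M.R l, i < j → i ∈ M.R j)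
    (hdet : ∀ l, (M.parentMatrix ρ l).det ≠ 0) (k : Fin (m + 1)) :
    ∃ a : E, (∀ j ∈ insert k (M.R k), ⟪a, x j⟫ = M.alpha ρ j) ∧
      (a = 0 ∨ ∃ N ≤ k.val - 1, IsShortenedBy (x 0) a N) := by
  have hnorm : ‖x 0‖ = 1 := by
    have := real_inner_self_eq_norm_sq (x 0)
    rw [hx, hd] at this
    exact (pow_eq_one_iff_of_nonneg (norm_nonneg _) two_ne_zero).mp this.symm
  have h00 : ⟪x 0, x 0⟫ = M.alpha ρ 0 := by rw [hx, hd, alpha_zero]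
  induction k using WellFoundedLT.induction with
  | ind k ih =>
    by_cases hk : k = 0
    · subst hk
      refine ⟨x 0, fun j hj => ?_, Or.inr ⟨0, Nat.zero_le _, isShortenedBy_self hnorm⟩⟩
      rcases Finset.mem_insert.mp hj with rfl | hj
      · exact h00
      · exact absurd (M.lt_of_mem 0 j hj) (Fin.not_lt_zero j)
    set V : Submodule ℝ E := Submodule.span ℝ (x '' (M.R k : Set (Fin (m + 1)))) with hV
    rcases (M.R k).eq_empty_or_nonempty with hR | hR
    · refine ⟨0, fun j hj => ?_, Or.inl rfl⟩
      rw [hR] at hj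
      obtain rfl : j = k := by simpa using hj
      have : IsEmpty (M.R j) := by rw [hR]; infer_instance
      rw [alpha_of_ne_zero M ρ hk, Finset.univ_eq_empty, Finset.sum_empty, inner_zero_left]
    set l := (M.R k).max' hR with hl
    have hlR : l ∈ M.R k := Finset.max'_mem _ _
    have hlk : l < k := M.lt_of_mem k l hlR
    -- With `0` as sole parent, `x 0` already lies in the span; counting a projection here would
    -- break the bound at `k = 1`.
    by_cases hl0 : l = 0
    · have hR0 : ∀ j ∈ M.R k, j = 0 := fun j hj =>
        le_antisymm (hl0 ▸ (M.R k).le_max' j hj) (Fin.zero_le j)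
      have hx0R : ∀ j ∈ M.R k, ⟪x 0, x j⟫ = M.alpha ρ j := fun j hj => by rw [hR0 j hj, h00]
      refine ⟨x 0, fun j hj => ?_, Or.inr ⟨0, Nat.zero_le _, isShortenedBy_self hnorm⟩⟩
      rcases Finset.mem_insert.mp hj with rfl | hj
      · exact inner_eq_alpha_of_mem_span M hx hk (hdet j)
          (Submodule.subset_span ⟨0, hl0 ▸ hlR, rfl⟩) hx0R
      · exact hx0R j hj
    obtain ⟨b, hbl, hb⟩ := ih l hlk
    have : FiniteDimensional ℝ V :=
      FiniteDimensional.span_of_finite ℝ ((M.R k).finite_toSet.image x)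
    have haR : ∀ j ∈ M.R k, ⟪V.starProjection b, x j⟫ = M.alpha ρ j := by
      intro j hj
      have hxj : x j ∈ V := Submodule.subset_span ⟨j, hj, rfl⟩
      rw [Submodule.inner_starProjection_left_eq_right, Submodule.starProjection_eq_self_iff.mpr hxj]
      refine hbl j (Finset.mem_insert.mpr ?_)
      -- By the clique property every parent of `k` is `l` or a parent of `l`, where `b` has the
      -- right inner products.
      rcases ((M.R k).le_max' j hj).eq_or_lt with h | h
      · exact Or.inl h
      · exact Or.inr (hM k l hlR j hj h)
    refine ⟨V.starProjection b, fun j hj => ?_, ?_⟩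
    · rcases Finset.mem_insert.mp hj with rfl | hj
      · exact inner_eq_alpha_of_mem_span M hx hk (hdet j) (V.starProjection_apply_mem b) haR
      · exact haR j hj
    · by_cases ha : V.starProjection b = 0
      · exact Or.inl ha
      rcases hb with rfl | ⟨N, hN, hb⟩
      · exact absurd (map_zero _) ha
      · have hl0' : l.val ≠ 0 := fun h => hl0 (Fin.ext h)
        have : l.val < k.val := hlk
        exact Or.inr ⟨N + 1, by omega, hb.starProjection V ha⟩

/-- For models whose sets of explanatory variables are cliques, the estimated correlation between
the extreme variables is bounded in terms of the true one. -/
theorem alpha_last_le (hm : 2 ≤ m) (hρ : ρ.PosSemidef) (hd : ∀ i, ρ i i = 1)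
    (hM : ∀ l, ∀ j ∈ M.R l, ∀ i ∈ M.R l, i < j → i ∈ M.R j)
    (hdet : ∀ l, (M.parentMatrix ρ l).det ≠ 0) :
    M.alpha ρ (Fin.last m) ≤ Real.cos (Real.arccos (ρ 0 (Fin.last m)) / m) ^ m := by
  obtain ⟨s, v, hv⟩ := Matrix.posSemidef_iff_eq_sum_vecMulVec.mp hρ
  let x : Fin (m + 1) → EuclideanSpace ℝ (Fin s) := fun i => WithLp.toLp 2 fun j => v j i
  have hx : ∀ i j, ⟪x i, x j⟫ = ρ i j := by
    intro i j
    rw [hv, Matrix.sum_apply]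
    simp [x, PiLp.inner_apply, Matrix.vecMulVec_apply, mul_comm]
  have hnorm : ∀ i, ‖x i‖ = 1 := fun i => by
    have := real_inner_self_eq_norm_sq (x i)
    rw [hx, hd] at this
    exact (pow_eq_one_iff_of_nonneg (norm_nonneg _) two_ne_zero).mp this.symm
  have hm' : (2 : ℝ) ≤ m := by exact_mod_cast hm
  have hangle : InnerProductGeometry.angle (x 0) (x (Fin.last m))
      = Real.arccos (ρ 0 (Fin.last m)) := by
    rw [InnerProductGeometry.angle, hx, hnorm, hnorm, mul_one, div_one]
  obtain ⟨a, ha, h⟩ := M.exists_isShortenedBy hx hd hM hdet (Fin.last m)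
  rw [← ha _ (Finset.mem_insert_self _ _), ← hangle]
  rcases h with rfl | ⟨N, hN, h⟩
  · rw [inner_zero_left]
    have h0 := InnerProductGeometry.angle_nonneg (x 0) (x (Fin.last m))
    have h1 := InnerProductGeometry.angle_le_pi (x 0) (x (Fin.last m))
    refine pow_nonneg (Real.cos_nonneg_of_mem_Icc ⟨?_, ?_⟩) m
    · have : 0 ≤ InnerProductGeometry.angle (x 0) (x (Fin.last m)) / m :=
        div_nonneg h0 (by positivity)
      linarith [Real.pi_pos]
    · rw [div_le_iff₀ (by positivity)]
      nlinarith [Real.pi_pos]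
  · exact inner_le_cos_div_pow hm (by rw [Fin.val_last] at hN; omega) (hnorm _) h

end RecursiveModel

/-! ### Null sets detected on lines, and measurability -/

section LinesAndMeasurability

/-- Fubini along parallel lines; it reduces genericity to polynomials in one variable. -/
theorem ae_mem_of_ae_add_smul_mem {ι : Type*} [Fintype ι] {s : Set (ι → ℝ)} (hs : MeasurableSet s)
    (d : ι → ℝ) (h : ∀ y, ∀ᵐ t : ℝ, y + t • d ∈ s) : ∀ᵐ y, y ∈ s :=
  ae_mem_of_ae_add_linearMap_mem (LinearMap.toSpanSingleton ℝ (ι → ℝ) d) volume volume hs h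

theorem ae_quadratic_ne_zero {a b : ℝ} (c : ℝ) (h : a ≠ 0 ∨ b ≠ 0) :
    ∀ᵐ t : ℝ, a * t ^ 2 + b * t + c ≠ 0 := by
  let p : Polynomial ℝ := .C a * .X ^ 2 + .C b * .X + .C c
  have hp : p ≠ 0 := by
    intro hp
    have h2 : p.coeff 2 = a := by simp [p]
    have h1 : p.coeff 1 = b := by simp [p, Polynomial.coeff_C, Polynomial.coeff_X_pow]
    rw [hp, Polynomial.coeff_zero] at h1 h2
    rcases h with h | h
    · exact h h2.symm
    · exact h h1.symm
  have hfin := (Polynomial.finite_setOfPred_isRoot hp).measure_zero (volume : Measure ℝ)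
  refine measure_mono_null (fun t ht => ?_) hfin
  have ht : a * t ^ 2 + b * t + c = 0 := not_not.mp ht
  simpa [p, Polynomial.IsRoot] using ht

variable {α n : Type*} [MeasurableSpace α] [Fintype n] [DecidableEq n]

theorem measurable_matrix_det {A : α → Matrix n n ℝ} (hA : ∀ i j, Measurable fun v => A v i j) :
    Measurable fun v => (A v).det := by
  simp only [Matrix.det_apply]
  fun_prop

theorem measurable_matrix_inv {A : α → Matrix n n ℝ} (hA : ∀ i j, Measurable fun v => A v i j)
    (i j : n) : Measurable fun v => (A v)⁻¹ i j := by
  simp only [Matrix.inv_def, Ring.inverse_eq_inv', Matrix.smul_apply, smul_eq_mul,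
    Matrix.adjugate_apply]
  refine (measurable_matrix_det hA).inv.mul (measurable_matrix_det fun k l => ?_)
  simp only [Matrix.updateRow_apply]
  split_ifs
  · exact measurable_const
  · exact hA k l

end LinesAndMeasurability

/-! ### Generic correlation matrices with a prescribed corner -/

section FillMatrix

variable {m : ℕ} (r : ℝ)

theorem fillMatrix_self (v : FreePair m → ℝ) (i : Fin (m + 1)) : fillMatrix r v i i = 1 := by
  simp [fillMatrix]

theorem fillMatrix_of_free (v : FreePair m → ℝ) {i j : Fin (m + 1)}
    (h : i < j ∧ (i, j) ≠ (0, Fin.last m)) : fillMatrix r v i j = v ⟨(i, j), h⟩ := by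
  rw [fillMatrix, Matrix.of_apply, dif_pos h]

theorem fillMatrix_symm (v : FreePair m → ℝ) (i j : Fin (m + 1)) :
    fillMatrix r v i j = fillMatrix r v j i := by
  simp only [fillMatrix, Matrix.of_apply]
  by_cases h1 : i < j ∧ (i, j) ≠ (0, Fin.last m)
  · rw [dif_pos h1, dif_neg fun h => lt_asymm h1.1 h.1, dif_pos h1]
  · rw [dif_neg h1, dif_neg h1]
    by_cases h2 : j < i ∧ (j, i) ≠ (0, Fin.last m)
    · rw [dif_pos h2, dif_pos h2]
    · rw [dif_neg h2, dif_neg h2]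
      simp only [eq_comm]

theorem fillMatrix_zero_last (hm : 1 ≤ m) (v : FreePair m → ℝ) :
    fillMatrix r v 0 (Fin.last m) = r := by
  have h : (0 : Fin (m + 1)) ≠ Fin.last m := by
    intro h
    have := congrArg Fin.val h
    simp only [Fin.val_zero, Fin.val_last] at this
    omega
  simp [fillMatrix, h]

/-- An off-diagonal entry of `fillMatrix r v` depends on a single free entry at most. -/
theorem fillMatrix_congr {v w : FreePair m → ℝ} {i j : Fin (m + 1)}
    (h : ∀ p : FreePair m, p.1 = (i, j) ∨ p.1 = (j, i) → v p = w p) :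
    fillMatrix r v i j = fillMatrix r w i j := by
  simp only [fillMatrix, Matrix.of_apply]
  split_ifs with h1 h2
  · exact h _ (Or.inl rfl)
  · exact h _ (Or.inr rfl)
  · rfl
  · rfl

theorem fillMatrix_convexCombination (v w : FreePair m → ℝ) {a b : ℝ} (hab : a + b = 1) :
    fillMatrix r (a • v + b • w) = a • fillMatrix r v + b • fillMatrix r w := by
  ext i j
  simp only [fillMatrix, Matrix.of_apply, Matrix.add_apply, Matrix.smul_apply, smul_eq_mul]
  split_ifs
  · rfl
  · rfl
  · linarith
  · rw [← add_mul, hab, one_mul]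

theorem measurable_fillMatrix (i j : Fin (m + 1)) :
    Measurable fun v : FreePair m → ℝ => fillMatrix r v i j := by
  simp only [fillMatrix, Matrix.of_apply]
  split_ifs <;> fun_prop

theorem convex_setOf_posSemidef_fillMatrix :
    Convex ℝ {v : FreePair m → ℝ | (fillMatrix r v).PosSemidef} := by
  intro v hv w hw a b ha hb hab
  change (fillMatrix r _).PosSemidef
  rw [fillMatrix_convexCombination r v w hab]
  exact (hv.smul ha).add (hw.smul hb)

/-- A singular correlation matrix stops being positive semidefinite under arbitrarily small
perturbations of its free entries. -/
theorem posDef_of_mem_interior (hm : 2 ≤ m) {v : FreePair m → ℝ}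
    (hv : v ∈ interior {v : FreePair m → ℝ | (fillMatrix r v).PosSemidef}) :
    (fillMatrix r v).PosDef := by
  have hmem : v ∈ {v : FreePair m → ℝ | (fillMatrix r v).PosSemidef} := interior_subset hv
  have hpsd : (fillMatrix r v).PosSemidef := hmem
  refine Matrix.PosDef.of_dotProduct_mulVec_pos hpsd.1 fun x hx => ?_
  refine lt_of_le_of_ne (hpsd.dotProduct_mulVec_nonneg x) fun h0 => hx ?_
  have hfree : ∀ i j, i < j → (i, j) ≠ ((0 : Fin (m + 1)), Fin.last m) → x i = 0 ∧ x j = 0 := by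
    intro i j hij hne
    let d : FreePair m → ℝ := Pi.single ⟨(i, j), hij, hne⟩ 1
    have hcont : ∀ c : ℝ, Filter.Tendsto (fun t : ℝ => v + (c * t) • d) (nhds 0) (nhds v) := by
      intro c
      have : Continuous fun t : ℝ => v + (c * t) • d := by fun_prop
      simpa using this.tendsto 0
    have hnhds := mem_interior_iff_mem_nhds.mp hv
    have hev := ((hcont 1).eventually hnhds).and ((hcont (-1)).eventually hnhds)
    obtain ⟨t, ⟨h1, h2⟩, ht⟩ :=
      ((hev.filter_mono (nhdsWithin_le_nhds (s := {0}ᶜ))).and self_mem_nhdsWithin).exists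
    have ht : t ≠ 0 := ht
    set A := fillMatrix r (v + (1 * t) • d)
    set B := fillMatrix r (v + (-1 * t) • d)
    have hA : A.PosSemidef := h1
    have hB : B.PosSemidef := h2
    have hmid : fillMatrix r v = (1 / 2 : ℝ) • A + (1 / 2 : ℝ) • B := by
      rw [← fillMatrix_convexCombination r _ _ (by norm_num)]
      congr 1
      ext p
      simp only [Pi.add_apply, Pi.smul_apply, smul_eq_mul]
      ring
    have hAx := hA.dotProduct_mulVec_nonneg x
    have hBx := hB.dotProduct_mulVec_nonneg x
    -- Both terms are nonnegative, so `x` is in the kernel of `A` and of `B`. Their difference has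
    -- only the entries `(i, j)` and `(j, i)`, both `2 * t`, which kills `x i` and `x j`.
    have hsum : (1 / 2 : ℝ) * (star x ⬝ᵥ (A *ᵥ x)) + (1 / 2 : ℝ) * (star x ⬝ᵥ (B *ᵥ x)) = 0 := by
      rw [hmid, Matrix.add_mulVec, dotProduct_add, Matrix.smul_mulVec, Matrix.smul_mulVec,
        dotProduct_smul, dotProduct_smul] at h0
      exact h0.symm
    have hA0 : A *ᵥ x = 0 := (hA.dotProduct_mulVec_zero_iff x).mp (by linarith)
    have hB0 : B *ᵥ x = 0 := (hB.dotProduct_mulVec_zero_iff x).mp (by linarith)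
    have hdiff : ∀ k l, (k, l) = (i, j) ∨ (l, k) = (i, j) → x l = 0 := by
      intro k l hkl
      have hAB : A k l - B k l = 2 * t := by
        rcases hkl with h | h
        · obtain ⟨rfl, rfl⟩ := Prod.mk.inj h
          simp only [A, B]
          rw [fillMatrix_of_free r _ ⟨hij, hne⟩, fillMatrix_of_free r _ ⟨hij, hne⟩]
          simp [d]; ring
        · obtain ⟨rfl, rfl⟩ := Prod.mk.inj h
          simp only [A, B]
          rw [fillMatrix_symm, fillMatrix_symm r _ k l, fillMatrix_of_free r _ ⟨hij, hne⟩,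
            fillMatrix_of_free r _ ⟨hij, hne⟩]
          simp [d]; ring
      have hother : ∀ l', l' ≠ l → A k l' - B k l' = 0 := by
        intro l' hl'
        rw [sub_eq_zero]
        refine fillMatrix_congr r fun p hp => ?_
        have : p ≠ ⟨(i, j), hij, hne⟩ := by
          rintro rfl
          simp only [Prod.mk.injEq] at hp hkl
          grind
        simp [d, this]
      have h := congrFun (show (A - B) *ᵥ x = 0 by rw [Matrix.sub_mulVec, hA0, hB0, sub_zero]) k
      rw [Matrix.mulVec, dotProduct, Finset.sum_eq_single l] at h
      · rw [Matrix.sub_apply, hAB, Pi.zero_apply] at h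
        simpa [ht] using h
      · intro l' _ hl'
        rw [Matrix.sub_apply, hother l' hl', zero_mul]
      · simp
    exact ⟨hdiff j i (Or.inr rfl), hdiff i j (Or.inl rfl)⟩
  ext i
  have h1 : (1 : Fin (m + 1)).val = 1 := by
    rw [Fin.val_one', Nat.mod_eq_of_lt (by omega)]
  -- For `m ≥ 2` the free pairs `(0, 1)` and `(1, i)`, `i > 1`, reach every index.
  have h01 := hfree 0 1 (by rw [Fin.lt_def, h1]; simp) (by
    intro h
    have := congrArg Fin.val (Prod.mk.inj h).2
    rw [h1, Fin.val_last] at this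
    omega)
  by_cases hi : i ≤ 1
  · rcases hi.eq_or_lt with rfl | hi
    · exact h01.2
    · have : i = 0 := by
        rw [Fin.lt_def, h1] at hi
        exact Fin.ext (by simpa using hi)
      rw [this]
      exact h01.1
  · refine (hfree 1 i (not_le.mp hi) fun h => ?_).2
    have := congrArg Fin.val (Prod.mk.inj h).1
    rw [h1] at this
    simp at this

/-- The frontier of a convex set is null, and interior points are positive definite. -/
theorem ae_posDef_of_posSemidef_fillMatrix (hm : 2 ≤ m) :
    ∀ᵐ v : FreePair m → ℝ, (fillMatrix r v).PosSemidef → (fillMatrix r v).PosDef := by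
  refine measure_mono_null (fun v hv => ?_)
    ((convex_setOf_posSemidef_fillMatrix r).addHaar_frontier volume)
  obtain ⟨hpsd, hpd⟩ := Classical.not_imp.mp hv
  exact ⟨subset_closure hpsd, fun h => hpd (posDef_of_mem_interior r hm h)⟩

theorem ae_forall_ne_zero : ∀ᵐ v : FreePair m → ℝ, ∀ p, v p ≠ 0 := by
  refine ae_all_iff.mpr fun p => ?_
  refine ae_mem_of_ae_add_smul_mem (s := {v | v p ≠ 0})
    ((measurableSet_singleton 0).compl.preimage (measurable_pi_apply p)) (Pi.single p 1) fun y => ?_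
  filter_upwards [ae_quadratic_ne_zero (a := 0) (b := 1) (y p) (Or.inr one_ne_zero)] with t ht
  change (y + t • Pi.single p (1 : ℝ) : FreePair m → ℝ) p ≠ 0
  simp only [Pi.add_apply, Pi.smul_apply, Pi.single_eq_same, smul_eq_mul]
  intro h
  exact ht (by linarith)

end FillMatrix

/-! ### Correct variances generically force cliques -/

namespace RecursiveModel

variable {m : ℕ} (M : RecursiveModel m)

section Measurability

variable {α : Type*} [MeasurableSpace α] {ρ : α → Matrix (Fin (m + 1)) (Fin (m + 1)) ℝ}

theorem measurable_beta (hρ : ∀ i j, Measurable fun v => ρ v i j) (k : Fin (m + 1)) (j : M.R k) :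
    Measurable fun v => M.beta (ρ v) k j := by
  simp only [beta, Matrix.vecMul, dotProduct]
  exact Finset.measurable_sum _ fun i _ =>
    (hρ _ _).mul (measurable_matrix_inv (fun _ _ => hρ _ _) i j)

theorem measurable_errVar (hρ : ∀ i j, Measurable fun v => ρ v i j) (k : Fin (m + 1)) :
    Measurable fun v => M.errVar (ρ v) k := by
  have := M.measurable_beta hρ k
  unfold errVar
  fun_prop

theorem measurable_alpha (hρ : ∀ i j, Measurable fun v => ρ v i j) (k : Fin (m + 1)) :
    Measurable fun v => M.alpha (ρ v) k := by
  induction k using WellFoundedLT.induction with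
  | ind k ih =>
    by_cases hk : k = 0
    · simp only [hk, alpha_zero, measurable_const]
    · simp only [alpha_of_ne_zero M _ hk]
      exact Finset.measurable_sum _ fun j _ =>
        (M.measurable_beta hρ k j).mul (ih j (M.lt_of_mem k j j.2))

theorem measurable_gamma (hρ : ∀ i j, Measurable fun v => ρ v i j) (k i : Fin (m + 1)) :
    Measurable fun v => M.gamma (ρ v) k i := by
  induction k using WellFoundedLT.induction with
  | ind k ih =>
    by_cases hk : k = 0
    · simp only [hk, gamma_zero, measurable_const]
    · simp only [gamma_of_ne_zero M _ hk]
      exact measurable_const.add (Finset.measurable_sum _ fun j _ =>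
        (M.measurable_beta hρ k j).mul (ih j (M.lt_of_mem k j j.2)))

theorem measurable_modelCov (hρ : ∀ i j, Measurable fun v => ρ v i j) (a b : Fin (m + 1)) :
    Measurable fun v => M.modelCov (ρ v) a b := by
  have h1 := M.measurable_alpha hρ
  have h2 := M.measurable_gamma hρ
  have h3 := M.measurable_errVar hρ
  unfold modelCov
  fun_prop

end Measurability

/-- Generically, variables which are not linked have a distorted estimated correlation. -/
theorem ae_modelCov_ne (r : ℝ) {k i j : Fin (m + 1)} (hM : M.IsPerfectBelow k) (hij : i < j)
    (hjk : j < k) (hi : i ∉ M.R j) :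
    ∀ᵐ v, M.modelCov (fillMatrix r v) i j ≠ fillMatrix r v i j := by
  have hfree : i < j ∧ (i, j) ≠ (0, Fin.last m) :=
    ⟨hij, fun h => ((Prod.mk.inj h).2 ▸ hjk).not_ge (Fin.le_last k)⟩
  refine ae_mem_of_ae_add_smul_mem (s := {v | M.modelCov (fillMatrix r v) i j ≠ fillMatrix r v i j})
    (measurableSet_eq_fun (M.measurable_modelCov (measurable_fillMatrix r) i j)
      (measurable_fillMatrix r i j)).compl (Pi.single ⟨(i, j), hfree⟩ 1) fun y => ?_
  have hconst : ∀ t : ℝ, M.modelCov (fillMatrix r (y + t • Pi.single ⟨(i, j), hfree⟩ 1)) i j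
      = M.modelCov (fillMatrix r y) i j := by
    intro t
    refine M.modelCov_congr (fun l hl a ha b hb => fillMatrix_congr r fun p hp => ?_)
      (hij.trans hjk) hjk
    -- If equation `l` involved both `i` and `j`, then either `l = j`, or both are parents of `l`
    -- and hence linked; each gives `i ∈ R j`.
    have hne : p ≠ ⟨(i, j), hfree⟩ := by
      rintro rfl
      have hil : i ∈ insert l (M.R l) := by
        rcases hp with h | h <;> obtain ⟨rfl, rfl⟩ := Prod.mk.inj h <;> assumption
      have hjl : j ∈ insert l (M.R l) := by
        rcases hp with h | h <;> obtain ⟨rfl, rfl⟩ := Prod.mk.inj h <;> assumption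
      rcases Finset.mem_insert.mp hil with rfl | hil
      · rcases Finset.mem_insert.mp hjl with rfl | hjl
        · exact lt_irrefl _ hij
        · exact lt_asymm hij (M.lt_of_mem _ _ hjl)
      · rcases Finset.mem_insert.mp hjl with rfl | hjl
        · exact hi hil
        · exact hi (hM l hl j hjl i hil hij)
    simp [hne]
  filter_upwards [ae_quadratic_ne_zero (a := 0) (b := 1)
    (y ⟨(i, j), hfree⟩ - M.modelCov (fillMatrix r y) i j) (Or.inr one_ne_zero)] with t ht
  rw [hconst, fillMatrix_of_free r _ hfree]
  simp only [Pi.add_apply, Pi.smul_apply, Pi.single_eq_same, smul_eq_mul]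
  intro h
  exact ht (by linarith)

/-- Generically, two explanatory variables with a distorted estimated correlation lead to a
distorted estimated variance. -/
theorem ae_estVar_ne (r : ℝ) {k a b : Fin (m + 1)} (ha : a ∈ M.R k) (hb : b ∈ M.R k) :
    ∀ᵐ v, (M.parentMatrix (fillMatrix r v) k).det ≠ 0 →
      fillMatrix r v 0 a ≠ 0 → fillMatrix r v 0 b ≠ 0 →
      M.modelCov (fillMatrix r v) a a = 1 → M.modelCov (fillMatrix r v) b b = 1 →
      M.modelCov (fillMatrix r v) a b ≠ fillMatrix r v a b → M.modelCov (fillMatrix r v) k k ≠ 1 := by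
  have hk : k ≠ 0 := Fin.ne_zero_of_lt (M.lt_of_mem k a ha)
  have hmeas : ∀ i j, Measurable fun v : FreePair m → ℝ => fillMatrix r v i j :=
    measurable_fillMatrix r
  set s := {v | (M.parentMatrix (fillMatrix r v) k).det ≠ 0 →
      fillMatrix r v 0 a ≠ 0 → fillMatrix r v 0 b ≠ 0 →
      M.modelCov (fillMatrix r v) a a = 1 → M.modelCov (fillMatrix r v) b b = 1 →
      M.modelCov (fillMatrix r v) a b ≠ fillMatrix r v a b →
      M.modelCov (fillMatrix r v) k k ≠ 1} with hs
  have hsm : MeasurableSet s := by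
    have hcov := M.measurable_modelCov hmeas
    have hne : ∀ f g : (FreePair m → ℝ) → ℝ, Measurable f → Measurable g →
        MeasurableSet {v | f v ≠ g v} := fun f g hf hg => (measurableSet_eq_fun hf hg).compl
    exact ((hne _ _ (measurable_matrix_det fun _ _ => hmeas _ _) measurable_const).imp
      ((hne _ _ (hmeas 0 a) measurable_const).imp ((hne _ _ (hmeas 0 b) measurable_const).imp
      ((measurableSet_eq_fun (hcov a a) measurable_const).imp
      ((measurableSet_eq_fun (hcov b b) measurable_const).imp
      ((hne _ _ (hcov a b) (hmeas a b)).imp (hne _ _ (hcov k k) measurable_const)))))))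
  -- the free entries of the `k`-th row vary, the earlier ones are kept fixed
  let L : (FreePair m → ℝ) →ₗ[ℝ] FreePair m → ℝ :=
    LinearMap.pi fun p => if p.1.2 = k then LinearMap.proj p else 0
  have hL : ∀ z p, L z p = if p.1.2 = k then z p else 0 := by
    intro z p
    by_cases hp : p.1.2 = k <;> simp [L, hp]
  -- The direction `d` below depends on the entries of `ρ` before `k`, so those are frozen first by
  -- `y`.
  refine ae_mem_of_ae_add_linearMap_mem L volume volume hsm fun y => ?_
  have hLm : Measurable fun z => y + L z :=
    (L.continuous_of_finiteDimensional.const_add y |>.measurable)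
  set ρ := fillMatrix r y with hρ
  have hsymm : ∀ i j, ρ i j = ρ j i := fillMatrix_symm r y
  -- The change of the `k`-th row that moves `β_k` along `e_a / ρ 0 a - e_b / ρ 0 b`. The weights
  -- make `w 0 = 0`, so the prescribed corner is respected when `k` is last and `0` is a parent.
  let w : Fin (m + 1) → ℝ := fun c => ρ a c / ρ 0 a - ρ b c / ρ 0 b
  let d : FreePair m → ℝ := fun p => if p.1.2 = k then w p.1.1 else 0
  refine ae_mem_of_ae_add_smul_mem (s := (fun z => y + L z) ⁻¹' s) (hLm hsm) d fun z => ?_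
  have hagree : ∀ u : FreePair m → ℝ, ∀ i < k, ∀ j < k, fillMatrix r (y + L u) i j = ρ i j := by
    intro u i hi j hj
    refine fillMatrix_congr r fun p hp => ?_
    have : p.1.2 ≠ k := by rcases hp with h | h <;> rw [h] <;> [exact hj.ne; exact hi.ne]
    rw [Pi.add_apply, hL, if_neg this, add_zero]
  have hlt : ∀ {c}, c ∈ M.R k → c < k := fun hc => M.lt_of_mem k _ hc
  have hcov : ∀ u : FreePair m → ℝ, ∀ i < k, ∀ j < k,
      M.modelCov (fillMatrix r (y + L u)) i j = M.modelCov ρ i j := by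
    intro u i hi j hj
    refine M.modelCov_congr (fun l hl e he f hf => ?_) hi hj
    have hle : ∀ e ∈ insert l (M.R l), e < k := by
      intro e he
      rcases Finset.mem_insert.mp he with rfl | he
      · exact hl
      · exact (M.lt_of_mem l e he).trans hl
    exact hagree u e (hle e he) f (hle f hf)
  have hpar : ∀ u : FreePair m → ℝ,
      M.parentMatrix (fillMatrix r (y + L u)) k = M.parentMatrix ρ k := by
    intro u
    ext i j
    exact hagree u i (hlt i.2) j (hlt j.2)
  by_cases hgood : (M.parentMatrix ρ k).det ≠ 0 ∧ ρ 0 a ≠ 0 ∧ ρ 0 b ≠ 0 ∧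
      M.modelCov ρ a a = 1 ∧ M.modelCov ρ b b = 1 ∧ M.modelCov ρ a b ≠ ρ a b
  swap
  · refine Filter.Eventually.of_forall fun t => ?_
    intro h1 h2 h3 h4 h5 h6
    have h0 : (0 : Fin (m + 1)) < k := Fin.pos_iff_ne_zero.mpr hk
    dsimp only at h1 h2 h3 h4 h5 h6
    rw [hpar] at h1
    rw [hagree _ _ h0 _ (hlt ha)] at h2
    rw [hagree _ _ h0 _ (hlt hb)] at h3
    rw [hcov _ _ (hlt ha) _ (hlt ha)] at h4
    rw [hcov _ _ (hlt hb) _ (hlt hb)] at h5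
    rw [hcov _ _ (hlt ha) _ (hlt hb), hagree _ _ (hlt ha) _ (hlt hb)] at h6
    exact absurd ⟨h1, h2, h3, h4, h5, h6⟩ hgood
  obtain ⟨hdet, h0a, h0b, haa, hbb, hdab⟩ := hgood
  let a' : M.R k := ⟨a, ha⟩
  let b' : M.R k := ⟨b, hb⟩
  let u : M.R k → ℝ := Pi.single a' (1 / ρ 0 a) - Pi.single b' (1 / ρ 0 b)
  let D : M.R k → M.R k → ℝ := fun i j => M.modelCov ρ i j - ρ i j
  set β := M.beta (fillMatrix r (y + L z)) k with hβ
  have hbeta : ∀ t : ℝ, M.beta (fillMatrix r (y + L (z + t • d))) k = β + t • u := by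
    intro t
    refine M.beta_eq_of_normal_eq _ (by rwa [hpar]) fun j => ?_
    have hj := hlt j.2
    have hβj := M.beta_normal_eq (fillMatrix r (y + L z)) (by rwa [hpar]) j
    have huj : ∑ i : M.R k, u i * ρ i j = w j := by
      simp only [u, w, Pi.sub_apply, sub_mul, Finset.sum_sub_distrib, Pi.single_apply, ite_mul,
        zero_mul, Finset.sum_ite_eq', Finset.mem_univ, if_true, a', b']
      ring
    have hrow : fillMatrix r (y + L (z + t • d)) k j = fillMatrix r (y + L z) k j + t * w j := by
      rw [fillMatrix_symm, fillMatrix_symm r _ k]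
      by_cases hfree : ((j : Fin (m + 1)), k) ≠ (0, Fin.last m)
      · rw [fillMatrix_of_free r _ ⟨hj, hfree⟩, fillMatrix_of_free r _ ⟨hj, hfree⟩]
        simp only [Pi.add_apply, hL, if_true, Pi.smul_apply, smul_eq_mul, d]
        ring
      · have hjk := Prod.mk.inj (not_not.mp hfree)
        have hw : w j = 0 := by
          simp only [w]
          rw [hjk.1, hsymm a, hsymm b, div_self h0a, div_self h0b,
            sub_self]
        rw [hw, mul_zero, add_zero]
        have hm : 1 ≤ m := by
          have := hjk.1 ▸ hj
          have hkm := k.2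
          rw [Fin.lt_def, Fin.val_zero] at this
          omega
        rw [hjk.1, hjk.2, fillMatrix_zero_last r hm, fillMatrix_zero_last r hm]
    rw [hrow, ← hβj, ← huj, Finset.mul_sum, ← Finset.sum_add_distrib]
    refine Finset.sum_congr rfl fun i _ => ?_
    rw [hagree _ _ (hlt i.2) _ hj, hagree _ _ (hlt i.2) _ hj]
    simp only [Pi.add_apply, Pi.smul_apply, smul_eq_mul]
    ring
  -- The leading coefficient in `t`: correct variances of `a` and `b` remove the diagonal terms,
  -- leaving only the cross term.
  have hquad : ∑ i, ∑ j, u i * u j * D i j ≠ 0 := by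
    have hDab : D a' b' ≠ 0 := sub_ne_zero.mpr hdab
    have hDba : D b' a' = D a' b' := by
      simp only [D, a', b']
      rw [modelCov_comm, hρ, fillMatrix_symm r y b a]
    have hDaa : D a' a' = 0 := by simp only [D, a']; rw [haa, hρ, fillMatrix_self, sub_self]
    have hDbb : D b' b' = 0 := by simp only [D, b']; rw [hbb, hρ, fillMatrix_self, sub_self]
    have : ∑ i, ∑ j, u i * u j * D i j = -2 * (1 / ρ 0 a) * (1 / ρ 0 b) * D a' b' := by
      simp only [u, Pi.sub_apply, sub_mul, mul_sub, Finset.sum_sub_distrib, Pi.single_apply,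
        ite_mul, mul_ite, zero_mul, mul_zero, Finset.sum_ite_eq', Finset.mem_univ, if_true,
        hDaa, hDbb, hDba]
      ring
    rw [this]
    have h1 : 1 / ρ 0 a ≠ 0 := one_div_ne_zero h0a
    have h2 : 1 / ρ 0 b ≠ 0 := one_div_ne_zero h0b
    exact mul_ne_zero (mul_ne_zero (mul_ne_zero (by norm_num) h1) h2) hDab
  filter_upwards [ae_quadratic_ne_zero (b := ∑ i, ∑ j, (β i * u j + u i * β j) * D i j)
    (∑ i, ∑ j, β i * β j * D i j) (Or.inl hquad)] with t ht
  intro _ _ _ _ _ _ hvar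
  apply ht
  rw [modelCov_self, M.estVar_eq _ hk (by rwa [hpar]), fillMatrix_self, add_eq_left, hbeta] at hvar
  rw [← hvar, Finset.sum_mul, Finset.sum_mul, ← Finset.sum_add_distrib, ← Finset.sum_add_distrib]
  refine Finset.sum_congr rfl fun i _ => ?_
  rw [Finset.sum_mul, Finset.sum_mul, ← Finset.sum_add_distrib, ← Finset.sum_add_distrib]
  refine Finset.sum_congr rfl fun j _ => ?_
  rw [hcov _ _ (hlt i.2) _ (hlt j.2), hagree _ _ (hlt i.2) _ (hlt j.2)]
  simp only [Pi.add_apply, Pi.smul_apply, smul_eq_mul, D]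
  ring

/-- Allows the exceptional null sets of all models to be united. -/
instance : Countable (RecursiveModel m) := by
  have : Function.Injective (RecursiveModel.R (m := m)) := by
    rintro ⟨R, _⟩ ⟨R', _⟩ rfl
    rfl
  exact this.countable

/-- For almost every correlation matrix, only models whose sets of explanatory variables are
cliques estimate all the variances correctly. -/
theorem ae_isPerfect_of_estVar_eq_one (hm : 2 ≤ m) (r : ℝ) :
    ∀ᵐ v : FreePair m → ℝ, (fillMatrix r v).PosSemidef → ∀ M : RecursiveModel m,
      (∀ k, M.estVar (fillMatrix r v) k = 1) →
      (∀ k, (M.parentMatrix (fillMatrix r v) k).det ≠ 0) ∧ ∀ k, M.IsPerfectBelow k ∧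
        ∀ j ∈ M.R k, ∀ i ∈ M.R k, i < j → i ∈ M.R j := by
  have h1 : ∀ᵐ v : FreePair m → ℝ, ∀ (M : RecursiveModel m) (k i j : Fin (m + 1)),
      M.IsPerfectBelow k → i < j → j < k → i ∉ M.R j →
      M.modelCov (fillMatrix r v) i j ≠ fillMatrix r v i j := by
    simp only [ae_all_iff]
    exact fun M k i j hM hij hjk hi => M.ae_modelCov_ne r hM hij hjk hi
  have h2 : ∀ᵐ v : FreePair m → ℝ, ∀ (M : RecursiveModel m) (k a b : Fin (m + 1)),
      a ∈ M.R k → b ∈ M.R k → (M.parentMatrix (fillMatrix r v) k).det ≠ 0 →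
      fillMatrix r v 0 a ≠ 0 → fillMatrix r v 0 b ≠ 0 →
      M.modelCov (fillMatrix r v) a a = 1 → M.modelCov (fillMatrix r v) b b = 1 →
      M.modelCov (fillMatrix r v) a b ≠ fillMatrix r v a b →
      M.modelCov (fillMatrix r v) k k ≠ 1 := by
    rw [ae_all_iff]; intro M
    rw [ae_all_iff]; intro k
    rw [ae_all_iff]; intro a
    rw [ae_all_iff]; intro b
    rw [ae_all_iff]; intro ha
    rw [ae_all_iff]; intro hb
    exact M.ae_estVar_ne r ha hb
  filter_upwards [h1, h2, ae_posDef_of_posSemidef_fillMatrix r hm, ae_forall_ne_zero]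
    with v h1 h2 hpd hne hpsd M hv
  have hdet : ∀ k, (M.parentMatrix (fillMatrix r v) k).det ≠ 0 := fun k =>
    ((hpd hpsd).submatrix Subtype.val_injective).det_pos.ne'
  refine ⟨hdet, fun k => ?_⟩
  induction k using WellFoundedLT.induction with
  | ind k ih =>
    have hbelow : M.IsPerfectBelow k := fun l hl => (ih l hl).2
    refine ⟨hbelow, fun j hj i hi hij => ?_⟩
    by_contra hij'
    have h0 : ∀ c ∈ M.R k, fillMatrix r v 0 c ≠ 0 := by
      intro c hc
      by_cases hc0 : c = 0
      · rw [hc0, fillMatrix_self]; exact one_ne_zero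
      · rw [fillMatrix_of_free r v ⟨Fin.pos_iff_ne_zero.mpr hc0, fun h =>
          ((Prod.mk.inj h).2 ▸ M.lt_of_mem k c hc).not_ge (Fin.le_last k)⟩]
        exact hne _
    have hvar : ∀ c, M.modelCov (fillMatrix r v) c c = 1 := fun c => by rw [modelCov_self, hv]
    exact h2 M k i j hi hj (hdet k) (h0 i hi) (h0 j hj) (hvar i) (hvar j)
      (h1 M k i j hbelow hij (M.lt_of_mem k j hj) hij') (hvar k)

end RecursiveModel

/-! ### The upper bound -/

namespace RecursiveModel

variable {m : ℕ} (M : RecursiveModel m) (ρ : Matrix (Fin (m + 1)) (Fin (m + 1)) ℝ)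

theorem estCorr_eq_alpha (h0 : ρ 0 0 = 1) {k : Fin (m + 1)} (hk : M.estVar ρ k = 1) :
    M.estCorr ρ k = M.alpha ρ k := by
  simp [estCorr, estCov, h0, hk]

/-- Here `alpha` is `r` with a parent and `0` without; the latter exceeds `r` only when `r < 0`. -/
theorem alpha_last_le_of_two_variables (M : RecursiveModel 1) {r : ℝ} (v : FreePair 1 → ℝ)
    (h : r < 0 → (M.R (Fin.last 1)).Nonempty) : M.alpha (fillMatrix r v) (Fin.last 1) ≤ r := by
  have hlast : (Fin.last 1) ≠ 0 := by decide
  have hz : ∀ j ∈ M.R (Fin.last 1), j = 0 := by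
    intro j hj
    have := M.lt_of_mem _ _ hj
    rw [Fin.lt_def, Fin.val_last] at this
    exact Fin.ext (by rw [Fin.val_zero]; omega)
  rw [alpha_of_ne_zero _ _ hlast]
  rcases (M.R (Fin.last 1)).eq_empty_or_nonempty with hR | hR
  · have : IsEmpty (M.R (Fin.last 1)) := by rw [hR]; infer_instance
    rw [Finset.univ_eq_empty, Finset.sum_empty]
    by_contra! hr
    exact (h hr).ne_empty hR
  · obtain ⟨j, hj⟩ := hR
    have hone : M.parentMatrix (fillMatrix r v) (Fin.last 1) = 1 := by
      ext a b
      have hab : a = b := Subtype.ext ((hz a a.2).trans (hz b b.2).symm)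
      rw [hab, Matrix.one_apply_eq]
      exact fillMatrix_self r v b
    have hn := M.beta_normal_eq (fillMatrix r v) (by rw [hone, Matrix.det_one]; exact one_ne_zero)
      ⟨j, hj⟩
    simp only [hz j hj] at hn
    rw [fillMatrix_symm, fillMatrix_zero_last r le_rfl] at hn
    refine ((Finset.sum_congr rfl fun i _ => ?_).trans hn).le
    rw [hz i i.2, fillMatrix_self, alpha_zero]

theorem ae_estCorr_last_le (hm : 1 ≤ m) {r : ℝ} (hr : r ∈ Set.Icc (-1 : ℝ) 1) :
    ∀ᵐ v : FreePair m → ℝ, (fillMatrix r v).PosSemidef → ∀ M : RecursiveModel m,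
      (m = 1 → r < 0 → (M.R (Fin.last m)).Nonempty) →
      (∀ k, M.estVar (fillMatrix r v) k = 1) →
      M.estCorr (fillMatrix r v) (Fin.last m) ≤ Real.cos (Real.arccos r / m) ^ m := by
  rcases hm.eq_or_lt with rfl | hm2
  · refine Filter.Eventually.of_forall fun v _ M hne hv => ?_
    rw [estCorr_eq_alpha M _ (fillMatrix_self r v 0) (hv _), Nat.cast_one, div_one, pow_one,
      Real.cos_arccos hr.1 hr.2]
    exact M.alpha_last_le_of_two_variables v (hne rfl)
  · filter_upwards [ae_isPerfect_of_estVar_eq_one hm2 r] with v h hpsd M _ hv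
    obtain ⟨hdet, hM⟩ := h hpsd M hv
    rw [estCorr_eq_alpha M _ (fillMatrix_self r v 0) (hv _)]
    have := M.alpha_last_le hm2 hpsd (fillMatrix_self r v) (fun l => (hM l).2) hdet
    rwa [fillMatrix_zero_last r hm] at this

end RecursiveModel

/-! ### The chain model -/

section Chain

variable {m : ℕ} {ρ : Matrix (Fin (m + 1)) (Fin (m + 1)) ℝ}

open RecursiveModel

theorem mem_chainModel_succ_iff {i : Fin m} {j : Fin (m + 1)} :
    j ∈ (chainModel m).R i.succ ↔ j = i.castSucc := by
  simp [chainModel, Fin.ext_iff]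

theorem sum_chainModel_succ {i : Fin m} (f : (chainModel m).R i.succ → ℝ) :
    ∑ j, f j = f ⟨i.castSucc, mem_chainModel_succ_iff.mpr rfl⟩ :=
  Finset.sum_eq_single _ (fun j _ hj =>
    absurd (Subtype.ext (mem_chainModel_succ_iff.mp j.2)) hj) (by simp)

theorem det_chainModel_ne_zero (hd : ∀ i, ρ i i = 1) (i : Fin m) :
    ((chainModel m).parentMatrix ρ i.succ).det ≠ 0 := by
  have : (chainModel m).parentMatrix ρ i.succ = 1 := by
    ext a b
    have hab : a = b := Subtype.ext
      ((mem_chainModel_succ_iff.mp a.2).trans (mem_chainModel_succ_iff.mp b.2).symm)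
    rw [hab, Matrix.one_apply_eq]
    exact hd b
  rw [this, Matrix.det_one]
  exact one_ne_zero

theorem beta_chainModel (hd : ∀ i, ρ i i = 1) (i : Fin m) :
    (chainModel m).beta ρ i.succ = fun _ => ρ i.succ i.castSucc := by
  refine beta_eq_of_normal_eq _ _ (det_chainModel_ne_zero hd i) fun j => ?_
  rw [sum_chainModel_succ, mem_chainModel_succ_iff.mp j.2, hd, mul_one]

/-- With a single parent the distortion form of `estVar_eq` has only a diagonal term, which vanishes
by induction. -/
theorem estVar_chainModel (hd : ∀ i, ρ i i = 1) (k : Fin (m + 1)) :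
    (chainModel m).estVar ρ k = 1 := by
  induction k using Fin.induction with
  | zero => rw [estVar_zero, hd]
  | succ i ih =>
    rw [estVar_eq _ _ (Fin.succ_ne_zero i) (det_chainModel_ne_zero hd i), sum_chainModel_succ,
      sum_chainModel_succ, modelCov_self, ih, hd, hd, sub_self, mul_zero, add_zero]

theorem alpha_chainModel {c : ℝ} (hd : ∀ i, ρ i i = 1)
    (hc : ∀ i : Fin m, ρ i.succ i.castSucc = c) (k : Fin (m + 1)) :
    (chainModel m).alpha ρ k = c ^ (k : ℕ) := by
  induction k using Fin.induction with
  | zero => rw [alpha_zero, Fin.val_zero, pow_zero]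
  | succ i ih =>
    rw [alpha_of_ne_zero _ _ (Fin.succ_ne_zero i), sum_chainModel_succ, beta_chainModel hd, ih,
      hc, Fin.val_castSucc, Fin.val_succ, pow_succ']

end Chain

/-! ### The extremal Gaussian distribution -/

section PlanarGaussian

variable (m : ℕ) (θ : ℝ)

theorem isGaussian_planarGaussian : IsGaussian (planarGaussian m θ) := by
  let L : ℝ × ℝ →L[ℝ] Fin (m + 1) → ℝ := ContinuousLinearMap.pi fun k =>
    Real.cos ((k : ℝ) * θ) • ContinuousLinearMap.fst ℝ ℝ ℝ +
      Real.sin ((k : ℝ) * θ) • ContinuousLinearMap.snd ℝ ℝ ℝ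
  have hL : (fun (s : ℝ × ℝ) (k : Fin (m + 1)) =>
      s.1 * Real.cos ((k : ℝ) * θ) + s.2 * Real.sin ((k : ℝ) * θ)) = L := by
    funext s k
    simp [L, mul_comm]
  unfold planarGaussian
  rw [hL]
  infer_instance

theorem integral_planarGaussian (k : Fin (m + 1)) : ∫ x, x k ∂(planarGaussian m θ) = 0 := by
  unfold planarGaussian
  rw [integral_map (f := fun x : Fin (m + 1) → ℝ => x k) (by fun_prop)
    (measurable_pi_apply k).aestronglyMeasurable]
  have h1 : Integrable (fun s : ℝ × ℝ => s.1) ((gaussianReal 0 1).prod (gaussianReal 0 1)) :=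
    (IsGaussian.integrable_id (μ := gaussianReal 0 1)).comp_fst _
  have h2 : Integrable (fun s : ℝ × ℝ => s.2) ((gaussianReal 0 1).prod (gaussianReal 0 1)) :=
    (IsGaussian.integrable_id (μ := gaussianReal 0 1)).comp_snd _
  rw [integral_add (h1.mul_const _) (h2.mul_const _), integral_mul_const, integral_mul_const,
    integral_fun_fst (f := fun x : ℝ => x), integral_fun_snd (f := fun x : ℝ => x)]
  simp

theorem covariance_planarGaussian (i j : Fin (m + 1)) :
    cov[fun x => x i, fun x => x j; planarGaussian m θ] =
      Real.cos (((i : ℝ) - (j : ℝ)) * θ) := by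
  unfold planarGaussian
  rw [covariance_map_fun (measurable_pi_apply i).aestronglyMeasurable
    (measurable_pi_apply j).aestronglyMeasurable (by fun_prop)]
  set γ := gaussianReal 0 1 with hγ
  have hid : MemLp id 2 γ := IsGaussian.memLp_two_id
  have h1 : MemLp (fun s : ℝ × ℝ => s.1) 2 (γ.prod γ) := hid.comp_fst _
  have h2 : MemLp (fun s : ℝ × ℝ => s.2) 2 (γ.prod γ) := hid.comp_snd _
  have h11 : cov[fun s : ℝ × ℝ => s.1, fun s => s.1; γ.prod γ] = 1 := by
    rw [covariance_self (by fun_prop)]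
    refine (measurePreserving_fst.variance_fun_comp (f := id) (by fun_prop)).trans ?_
    simp [hγ]
  have h22 : cov[fun s : ℝ × ℝ => s.2, fun s => s.2; γ.prod γ] = 1 := by
    rw [covariance_self (by fun_prop)]
    refine (measurePreserving_snd.variance_fun_comp (f := id) (by fun_prop)).trans ?_
    simp [hγ]
  have h12 : cov[fun s : ℝ × ℝ => s.1, fun s => s.2; γ.prod γ] = 0 :=
    covariance_fst_snd_prod hid hid
  have h21 : cov[fun s : ℝ × ℝ => s.2, fun s => s.1; γ.prod γ] = 0 := by
    rw [covariance_comm, h12]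
  have e := fun (c d : ℝ) => (h1.mul_const c).add (h2.mul_const d)
  have hsplit := covariance_add_left (h1.mul_const (Real.cos ((i : ℝ) * θ)))
    (h2.mul_const (Real.sin ((i : ℝ) * θ)))
    (e (Real.cos ((j : ℝ) * θ)) (Real.sin ((j : ℝ) * θ)))
  refine hsplit.trans ?_
  rw [covariance_add_right (h1.mul_const _) (h1.mul_const _) (h2.mul_const _),
    covariance_add_right (h2.mul_const _) (h1.mul_const _) (h2.mul_const _)]
  simp only [covariance_mul_const_left, covariance_mul_const_right, h11, h22, h12, h21]
  rw [sub_mul, Real.cos_sub]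
  ring

theorem variance_planarGaussian (k : Fin (m + 1)) :
    Var[fun x => x k; planarGaussian m θ] = 1 := by
  rw [← covariance_self (measurable_pi_apply k).aemeasurable, covariance_planarGaussian, sub_self, zero_mul, Real.cos_zero]

theorem corrMatrix_planarGaussian (i j : Fin (m + 1)) :
    corrMatrix (planarGaussian m θ) i j = Real.cos (((i : ℝ) - (j : ℝ)) * θ) := by
  simp [corrMatrix, covariance_planarGaussian, variance_planarGaussian]

end PlanarGaussian

theorem theorem1 (m : ℕ) (hm : 1 ≤ m) (r : ℝ) (hr : r ∈ Set.Icc (-1 : ℝ) 1) :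
    -- the upper bound, with `n = m + 1` variables
    (∀ᵐ v : FreePair m → ℝ, (fillMatrix r v).PosSemidef →
      ∀ M : RecursiveModel m,
        (m = 1 → r < 0 → (M.R (Fin.last m)).Nonempty) →
        (∀ k, M.estVar (fillMatrix r v) k = 1) →
        M.estCorr (fillMatrix r v) (Fin.last m) ≤ Real.cos (Real.arccos r / m) ^ m) ∧
    -- the bound is attained
    IsGaussian (planarGaussian m (Real.arccos r / m)) ∧
    (∀ k, ∫ x, x k ∂(planarGaussian m (Real.arccos r / m)) = 0) ∧
    (∀ k, Var[fun x => x k; planarGaussian m (Real.arccos r / m)] = 1) ∧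
    corrMatrix (planarGaussian m (Real.arccos r / m)) 0 (Fin.last m) = r ∧
    (∀ k, (chainModel m).estVar (corrMatrix (planarGaussian m (Real.arccos r / m))) k = 1) ∧
    (chainModel m).estCorr (corrMatrix (planarGaussian m (Real.arccos r / m))) (Fin.last m) =
      Real.cos (Real.arccos r / m) ^ m := by
  have hm0 : (m : ℝ) ≠ 0 := by exact_mod_cast (by omega : m ≠ 0)
  set θ := Real.arccos r / m with hθ
  have hd : ∀ i, corrMatrix (planarGaussian m θ) i i = 1 := fun i => by
    rw [corrMatrix_planarGaussian, sub_self, zero_mul, Real.cos_zero]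
  refine ⟨RecursiveModel.ae_estCorr_last_le hm hr, isGaussian_planarGaussian m θ,
    integral_planarGaussian m θ, variance_planarGaussian m θ, ?_, estVar_chainModel hd, ?_⟩
  · rw [corrMatrix_planarGaussian, Fin.val_zero, Fin.val_last, Nat.cast_zero, zero_sub, neg_mul,
      Real.cos_neg, hθ, mul_div_cancel₀ _ hm0, Real.cos_arccos hr.1 hr.2]
  · rw [RecursiveModel.estCorr_eq_alpha _ _ (hd 0) (estVar_chainModel hd _),
      alpha_chainModel (c := Real.cos θ) hd fun i => ?_, Fin.val_last]
    rw [corrMatrix_planarGaussian, Fin.val_succ, Fin.val_castSucc]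
    congr 1
    push_cast
    ring
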